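/- Let $A$ be a finite alphabet. A stream is a finite sequence $\sigma=((\lambda_1,a_1),\dots,(\lambda_L,a_L))$, $L\ge 1$, of events with $\lambda_i>0$ and $a_i\in A$; $L$ is its number of events. Let $\mathcal F=\mathbb R\langle\langle A\rangle\rangle$ be the algebra of formal power series $f=\sum_w f_w w$ over the words $w$ in $A$ (non-commutative multiplication extending concatenation of words). Let the event map $p$ be either $p(\lambda,a)=\exp(\lambda a)=\sum_{n\ge0}\lambda^n a^n/n!$ or $p(\lambda,a)=1+\lambda a$, and let $\Phi(\sigma)=p(\lambda_1,a_1)\cdots p(\lambda_L,a_L)\in\mathcal F$, with coordinates $\Phi_w(\sigma)$. Identify the letters with the standard orthonormal basis of $\mathbb R^{A}$ and let $\gamma_\sigma:[0,1]\to\mathbb R^{A}$ be the lattice path $$\gamma_\sigma(t)=(tL-\lfloor tL\rfloor)\,\lambda_{\lceil tL\rceil}a_{\lceil tL\rceil}+\sum_{i=1}^{\lfloor tL\rfloor}\lambda_i a_i .$$ Write $\|\gamma\|_1$ for the total variation of a path on $[0,1]$, $\|\sigma\|_1=\sum_{i}|\lambda_i|$, $\|f\|_1=\sum_w|f_w|\in[0,\infty]$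 and $\|f\|_{1,(M)}=\sum_{|w|=M}|f_w|$. Call $f\in\mathcal F$ group-like if $f_\emptyset=1$ and $\Delta f=f\otimes f$, where $\Delta$ is the coproduct dual to the shuffle product, $\langle u\otimes v,\Delta f\rangle=\langle u\sqcup\!\!\sqcup v,f\rangle$ for all words $u,v$ with shuffle product $u\sqcup\!\!\sqcup v$. (1) Let $(\sigma^n)_{n\ge1}$ be streams and $\gamma=(\gamma^a)_{a\in A}:[0,1]\to\mathbb R^{A}$ a continuous path of bounded variation with $\|\gamma_{\sigma^n}-\gamma\|_1\to0$. If $p(\lambda,a)=1+\lambda a$, assume in addition that the number of events of $\sigma^n$ tends to infinity. Then for every word $w=a_1\cdots a_M$, $$\lim_{n\to\infty}\Phi_w(\sigma^n)=\int_{0\le t_1\le\cdots\le t_M\le1}d\gamma^{a_1}(t_1)\cdots d\gamma^{a_M}(t_M),$$ and the coordinatewise limit of $\Phi(\sigma^n)$ is group-like. (2) For every stream $\sigma$ one has $\|\sigma\|_1=\|\gamma_\sigma\|_1$, $$\|\Phi(\sigma)\|_{1,(M)}\le\frac{\|\sigma\|_1^M}{M!}\quad(M\ge0)\qquad\text{and}\qquad\|\Phi(\sigma)\|_1\le\exp(\|\sigma\|_1),$$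 and all these inequalities are equalities if $p(\lambda,a)=\exp(\lambda a)$. (3) For all streams $\sigma,\tau$, the concatenated stream $(\sigma,\tau)$ satisfies $\Phi(\sigma,\tau)=\Phi(\sigma)\cdot\Phi(\tau)$. -/

import Mathlib

open Filter Topology MeasureTheory

noncomputable section

/-! ### Events and streams -/

/-- An event `(λ, a)` with counter increase `λ > 0` in the letter `a`. -/
structure StreamEvent (A : Type*) where
  weight : ℝ
  letter : A
  weight_pos : 0 < weight

/-- Streams: finite sequences of events, of length at least one. -/
def EventStream (A : Type*) : Type _ := {l : List (StreamEvent A) // l ≠ []}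

namespace EventStream

/-- The number of events of a stream. -/
def length {A : Type*} (σ : EventStream A) : ℕ := σ.1.length

/-- Concatenation of streams, `σ` followed by `τ`. -/
def concat {A : Type*} (σ τ : EventStream A) : EventStream A :=
  ⟨σ.1 ++ τ.1, List.append_ne_nil_of_left_ne_nil σ.2 τ.1⟩

/-- The length `‖σ‖₁ = ∑ |λᵢ|`. -/
def norm₁ {A : Type*} (σ : EventStream A) : ℝ := (σ.1.map fun e => |e.weight|).sum

/-- The vector `λᵢ aᵢ` of the `i`-th event (counted from `0`), the letters being identified with the
standard orthonormal basis; zero when there is no such event. -/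
def stepVector {A : Type*} [Fintype A] [DecidableEq A] (σ : EventStream A) (i : ℕ) :
    EuclideanSpace ℝ A :=
  if h : i < σ.1.length then EuclideanSpace.single (σ.1[i]).letter (σ.1[i]).weight else 0

/-- The embedding of a stream as a lattice path: linear interpolation, at constant speed on each of
the `L` intervals `[i / L, (i + 1) / L]`, of the partial sums of the vectors `λᵢ aᵢ`. -/
def path {A : Type*} [Fintype A] [DecidableEq A] (σ : EventStream A) (t : unitInterval) :
    EuclideanSpace ℝ A :=
  Int.fract ((t : ℝ) * σ.length) • σ.stepVector ⌊(t : ℝ) * σ.length⌋₊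
    + ∑ i ∈ Finset.range ⌊(t : ℝ) * σ.length⌋₊, σ.stepVector i

end EventStream

/-! ### The feature space of non-commutative formal power series -/

/-- Formal power series `∑ c_w w` over the words `w` in the letters `A`, given by the coefficients
`c_w`; words are lists of letters. -/
def FeatureSpace (A : Type*) : Type _ := List A → ℝ

namespace FeatureSpace

instance {A : Type*} : One (FeatureSpace A) :=
  ⟨fun w => match w with
    | [] => 1
    | _ :: _ => 0⟩

/-- The (non-commutative) multiplication that extends concatenation of words: the coefficient of `w`
is the sum over all ways to cut `w` in two. -/
instance {A : Type*} : Mul (FeatureSpace A) :=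
  ⟨fun f g w => ∑ i ∈ Finset.range (w.length + 1), f (w.take i) * g (w.drop i)⟩

theorem one_nil {A : Type*} : (1 : FeatureSpace A) [] = 1 := rfl

theorem one_cons {A : Type*} (a : A) (w : List A) : (1 : FeatureSpace A) (a :: w) = 0 := rfl

theorem mul_apply {A : Type*} (f g : FeatureSpace A) (w : List A) :
    (f * g) w = ∑ i ∈ Finset.range (w.length + 1), f (w.take i) * g (w.drop i) := rfl

theorem mul_nil {A : Type*} (f g : FeatureSpace A) : (f * g) [] = f [] * g [] := by
  simp [mul_apply]

/-- The series `∑ c_{a w} w`. -/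
def tailAt {A : Type*} (f : FeatureSpace A) (a : A) : FeatureSpace A := fun w => f (a :: w)

theorem mul_cons {A : Type*} (f g : FeatureSpace A) (a : A) (w : List A) :
    (f * g) (a :: w) = f [] * g (a :: w) + (f.tailAt a * g) w := by
  rw [mul_apply, mul_apply, List.length_cons, Finset.sum_range_succ']
  simp [tailAt, add_comm]

theorem mul_assoc_apply {A : Type*} (g h : FeatureSpace A) (w : List A) :
    ∀ f : FeatureSpace A, (f * g * h) w = (f * (g * h)) w := by
  induction w with
  | nil => intro f; simp only [mul_nil]; ring
  | cons a w ih =>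
    intro f
    have key : ((f * g).tailAt a * h) w =
        f [] * (g.tailAt a * h) w + (f.tailAt a * g * h) w := by
      simp only [mul_apply _ h, Finset.mul_sum, ← Finset.sum_add_distrib]
      refine Finset.sum_congr rfl fun i _ => ?_
      have h1 : (f * g).tailAt a (w.take i) =
          f [] * g.tailAt a (w.take i) + (f.tailAt a * g) (w.take i) := mul_cons f g a _
      rw [h1]
      ring
    rw [mul_cons (f * g) h, mul_cons f (g * h), mul_cons g h, key, ih, mul_nil]
    ring

instance {A : Type*} : Monoid (FeatureSpace A) where
  mul_assoc f g h := funext fun w => mul_assoc_apply g h w f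
  one_mul f := funext fun w => by
    have h0 : ∀ a : A, ∀ v : List A, (1 : FeatureSpace A).tailAt a v = 0 := fun a v => rfl
    cases w with
    | nil => rw [mul_nil, one_nil, one_mul]
    | cons a w => rw [mul_cons, one_nil, mul_apply, Finset.sum_eq_zero] <;> simp [h0]
  mul_one f := funext fun w => by
    rw [mul_apply, Finset.sum_range_succ, Finset.sum_eq_zero]
    · rw [List.drop_length, List.take_length, one_nil, mul_one, zero_add]
    · intro i hi
      have hi' : i < w.length := Finset.mem_range.1 hi
      rw [List.drop_eq_getElem_cons hi', one_cons, mul_zero]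

/-- `‖f‖_{1,(M)}`, the sum of `|c_w|` over the words `w` of length `M`. -/
def normLevel {A : Type*} [Fintype A] (f : FeatureSpace A) (M : ℕ) : ℝ :=
  ∑ w : Fin M → A, |f (List.ofFn w)|

/-- `‖f‖₁`, the sum of `|c_w|` over all words, with value `∞` when it diverges. -/
def norm₁ {A : Type*} (f : FeatureSpace A) : ENNReal :=
  ∑' w : List A, ENNReal.ofReal |f w|

end FeatureSpace

/-! ### Event maps and the feature map -/

/-- The event map `(λ, a) ↦ exp (λ a) = ∑ₙ λⁿ aⁿ / n!`. -/
def expEventMap (A : Type*) [DecidableEq A] (e : StreamEvent A) : FeatureSpace A :=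
  fun w => if w = List.replicate w.length e.letter
    then e.weight ^ w.length / (Nat.factorial w.length : ℝ) else 0

/-- The event map `(λ, a) ↦ 1 + λ a`. -/
def linEventMap (A : Type*) [DecidableEq A] (e : StreamEvent A) : FeatureSpace A :=
  fun w => if w = [] then 1 else if w = [e.letter] then e.weight else 0

/-- The feature map `Φ(σ) = p(σ₁) ⋯ p(σ_L)` of the event map `p`. -/
def featureMap {A : Type*} (p : StreamEvent A → FeatureSpace A) (σ : EventStream A) :
    FeatureSpace A :=
  (σ.1.map p).prod

/-! ### Group-like series -/

/-- The shuffle product of two words, an element of the space of finite formal sums of words. -/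
def shuffle {A : Type*} : List A → List A → (List A →₀ ℝ)
  | [], v => Finsupp.single v 1
  | a :: u, [] => Finsupp.single (a :: u) 1
  | a :: u, b :: v =>
      (shuffle u (b :: v)).mapDomain (List.cons a) + (shuffle (a :: u) v).mapDomain (List.cons b)
termination_by u v => u.length + v.length

/-- The pairing `⟨ℓ, f⟩ = ∑ ℓ_w f_w` of a finite sum of words with a power series. -/
def wordPairing {A : Type*} (ℓ : List A →₀ ℝ) (f : FeatureSpace A) : ℝ :=
  ℓ.sum fun w c => c * f w

namespace FeatureSpace

/-- The counit: the coefficient of the empty word. -/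
def counit {A : Type*} (f : FeatureSpace A) : ℝ := f []

/-- The coproduct `Δ` dual to the shuffle product, `⟨u ⊗ v, Δ f⟩ = ⟨u ⧢ v, f⟩`. Its values lie in the
completed tensor square, i.e. they are power series `∑ c_{u,v} u ⊗ v`, given by coefficients. -/
def coproduct {A : Type*} (f : FeatureSpace A) : List A → List A → ℝ :=
  fun u v => wordPairing (shuffle u v) f

/-- The element `f ⊗ g` of the completed tensor square. -/
def tensor {A : Type*} (f g : FeatureSpace A) : List A → List A → ℝ :=
  fun u v => f u * g v

/-- Group-like elements: `ε(f) = 1` and `Δ f = f ⊗ f`. -/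
def IsGroupLike {A : Type*} (f : FeatureSpace A) : Prop :=
  f.counit = 1 ∧ f.coproduct = f.tensor f

end FeatureSpace

/-! ### Iterated integrals of paths of bounded variation -/

theorem boundedVariationOn_coord {A : Type*} [Fintype A] {γ : unitInterval → EuclideanSpace ℝ A}
    (hγ : BoundedVariationOn γ Set.univ) (a : A) :
    BoundedVariationOn (fun t => γ t a) Set.univ := by
  have h : LipschitzWith 1 (fun x : EuclideanSpace ℝ A => x a) :=
    LipschitzWith.of_dist_le_mul fun x y => by
      simpa [dist_eq_norm] using PiLp.norm_apply_le (x - y) a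
  exact h.comp_boundedVariationOn hγ

/-- The signed Lebesgue-Stieltjes measure `dγ^a` of a coordinate of a path of bounded variation. -/
def coordMeasure {A : Type*} [Fintype A] (γ : unitInterval → EuclideanSpace ℝ A)
    (hγ : BoundedVariationOn γ Set.univ) (a : A) : SignedMeasure unitInterval :=
  (boundedVariationOn_coord hγ a).vectorMeasure

/-- The function `t ↦ ∫_{0 ≤ t₁ ≤ ⋯ ≤ t_M ≤ t} dγ^{a₁}(t₁) ⋯ dγ^{a_M}(t_M)` of the word
`a₁ ⋯ a_M`, computed from the inside out: starting with the constant function `1`, the letters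
`a₁, …, a_M` act in turn by `F ↦ (t ↦ ∫_{[0, t]} F dγ^{a})`. -/
def iteratedIntegralTo {A : Type*} [Fintype A] (γ : unitInterval → EuclideanSpace ℝ A)
    (hγ : BoundedVariationOn γ Set.univ) (w : List A) : unitInterval → ℝ :=
  w.foldl (fun F a t => ∫ᵛ s in Set.Icc 0 t, F s ∂•(coordMeasure γ hγ a)) (fun _ => 1)

/-- The power series of the iterated integrals `∫_{0 ≤ t₁ ≤ ⋯ ≤ t_M ≤ 1} dγ^{a₁} ⋯ dγ^{a_M}`. -/
def iteratedIntegrals {A : Type*} [Fintype A] (γ : unitInterval → EuclideanSpace ℝ A)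
    (hγ : BoundedVariationOn γ Set.univ) : FeatureSpace A :=
  fun w => iteratedIntegralTo γ hγ w 1

end

noncomputable section

/-! Both event maps have non-negative coefficients, are dominated coefficientwise by the exponential
and agree with it to first order; `IsEventMap` records this.

Estimates: absolute values play no role, and summing coefficients over words of length `M` turns
products into Cauchy products (`levelSum_mul`). For the exponential the binomial theorem then gives
equality; domination gives the inequality in general. Lattice paths are monotone in each coordinate,
so their variation is read off from the sum of the coordinates.

Limits: write `F_w` for the iterated integral as a function of its endpoint. The coefficient of `wa`
in the product of the first `k` events satisfies a difference equation that discretises `dF_{wa} =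
F_w dγ^a`, up to errors quadratic in the weights. Induction on the word gives convergence uniformly
along the grid `k / N` (`abs_sub_setIntegral_le`, `abs_prod_map_take_sub_le`). The errors are
controlled by the variation of the difference of the paths, the modulus of continuity of `F_w`, and
the largest weight times the total weight. The largest weight vanishes because `γ` is continuous and
`N` tends to infinity. For the exponential, `N` can be made large at will: cutting events into equal
parts changes neither the path nor the features (`prod_map_exp_subdivide`).

Group-likeness: exponentials of letters are group-like, the coproduct is multiplicative
(`coproduct_mul`), and the defining identities involve finitely many coefficients, hence survive
limits. Both event maps have the same limit, so the exponential case suffices. -/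

namespace FeatureSpace

variable {A : Type*}

/-! ### Sums of coefficients over the words of a given length -/

/-- The sum of the coefficients over the words of length `M`. -/
def levelSum [Fintype A] (f : FeatureSpace A) (M : ℕ) : ℝ := ∑ w : Fin M → A, f (List.ofFn w)

theorem levelSum_zero [Fintype A] (f : FeatureSpace A) : f.levelSum 0 = f [] := by
  simp [levelSum]

theorem levelSum_succ [Fintype A] (f : FeatureSpace A) (M : ℕ) :
    f.levelSum (M + 1) = ∑ a, (f.tailAt a).levelSum M := by
  rw [levelSum, ← (Fin.consEquiv fun _ => A).sum_comp, Fintype.sum_prod_type]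
  simp [levelSum, tailAt, Fin.consEquiv, List.ofFn_succ]

/-- Sending every letter to a single variable is an algebra homomorphism to power series in one
variable. The induction peels off the first letter of the word. -/
theorem levelSum_mul [Fintype A] (g : FeatureSpace A) (M : ℕ) (f : FeatureSpace A) :
    (f * g).levelSum M = ∑ i ∈ Finset.range (M + 1), f.levelSum i * g.levelSum (M - i) := by
  induction M generalizing f with
  | zero => simp [levelSum_zero, mul_nil]
  | succ M ih =>
    have h : ∀ a, ((f * g).tailAt a).levelSum M =
        f [] * (g.tailAt a).levelSum M + (f.tailAt a * g).levelSum M := by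
      intro a
      simp only [levelSum, Finset.mul_sum, ← Finset.sum_add_distrib]
      exact Finset.sum_congr rfl fun w _ => mul_cons f g a _
    rw [levelSum_succ, Finset.sum_congr rfl fun a _ => h a, Finset.sum_add_distrib,
      ← Finset.mul_sum, ← levelSum_succ, Finset.sum_range_succ', levelSum_zero, Nat.sub_zero,
      add_comm]
    congr 1
    simp only [ih]
    rw [Finset.sum_comm]
    refine Finset.sum_congr rfl fun i _ => ?_
    rw [levelSum_succ, Finset.sum_mul, Nat.add_sub_add_right]

theorem le_levelSum [Fintype A] {f : FeatureSpace A} (hf : ∀ w, 0 ≤ f w) (w : List A) :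
    f w ≤ f.levelSum w.length := by
  have h := Finset.single_le_sum (f := fun v : Fin w.length → A => f (List.ofFn v))
    (fun v _ => hf _) (Finset.mem_univ w.get)
  rw [List.ofFn_get] at h
  exact h

theorem norm₁_eq_tsum_normLevel [Fintype A] (f : FeatureSpace A) :
    f.norm₁ = ∑' M, ENNReal.ofReal (f.normLevel M) := by
  rw [norm₁, ← (List.equivSigmaTuple (α := A)).symm.tsum_eq, ENNReal.tsum_sigma']
  refine tsum_congr fun M => ?_
  rw [tsum_fintype, normLevel, ENNReal.ofReal_sum_of_nonneg fun _ _ => abs_nonneg _]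
  rfl

/-! ### Power series in one letter -/

/-- The power series `∑ cₙ aⁿ` in the letter `a`. -/
def ofLetter [DecidableEq A] (a : A) (c : ℕ → ℝ) : FeatureSpace A :=
  fun w => if w = List.replicate w.length a then c w.length else 0

/-- Unlike an equation with `List.replicate`, this condition splits along every cut of `w`. -/
theorem ofLetter_apply [DecidableEq A] (a : A) (c : ℕ → ℝ) (w : List A) :
    ofLetter a c w = if ∀ b ∈ w, b = a then c w.length else 0 := by
  simp only [ofLetter, List.eq_replicate_length]

theorem tailAt_ofLetter [DecidableEq A] (a b : A) (c : ℕ → ℝ) :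
    (ofLetter a c).tailAt b = ofLetter a fun n => if b = a then c (n + 1) else 0 := by
  funext w
  by_cases h : b = a <;> simp [tailAt, ofLetter_apply, h]

theorem ofLetter_mul [DecidableEq A] (a : A) (c d : ℕ → ℝ) :
    ofLetter a c * ofLetter a d =
      ofLetter a fun n => ∑ i ∈ Finset.range (n + 1), c i * d (n - i) := by
  funext w
  rw [mul_apply]
  simp only [ofLetter_apply]
  split_ifs with h
  · refine Finset.sum_congr rfl fun i hi => ?_
    rw [if_pos fun b hb => h b (List.mem_of_mem_take hb),
      if_pos fun b hb => h b (List.mem_of_mem_drop hb), List.length_take, List.length_drop,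
      min_eq_left (Nat.lt_succ_iff.1 (Finset.mem_range.1 hi))]
  · refine Finset.sum_eq_zero fun i _ => ?_
    by_cases h1 : ∀ b ∈ w.take i, b = a
    · rw [if_neg (c := ∀ b ∈ w.drop i, b = a), mul_zero]
      intro h2
      refine h fun b hb => ?_
      rw [← List.take_append_drop i w, List.mem_append] at hb
      exact hb.elim (h1 b) (h2 b)
    · rw [if_neg h1, zero_mul]

theorem levelSum_ofLetter [Fintype A] [DecidableEq A] (a : A) (c : ℕ → ℝ) (M : ℕ) :
    (ofLetter a c).levelSum M = c M := by
  rw [levelSum, Finset.sum_eq_single fun _ => a]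
  · simp [ofLetter_apply]
  · intro w _ hw
    rw [ofLetter_apply, if_neg]
    intro h
    exact hw (funext fun i => h _ ((List.mem_ofFn' _ _).2 ⟨i, rfl⟩))
  · simp

end FeatureSpace

theorem sum_pow_div_factorial_mul (x y : ℝ) (n : ℕ) :
    ∑ i ∈ Finset.range (n + 1), x ^ i / (Nat.factorial i : ℝ) *
      (y ^ (n - i) / (Nat.factorial (n - i) : ℝ)) = (x + y) ^ n / (Nat.factorial n : ℝ) := by
  rw [add_pow, Finset.sum_div]
  refine Finset.sum_congr rfl fun i hi => ?_
  have hi' : i ≤ n := Nat.lt_succ_iff.1 (Finset.mem_range.1 hi)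
  rw [Nat.cast_choose ℝ hi']
  have := Nat.factorial_ne_zero n
  field_simp

theorem EventStream.norm₁_eq {A : Type*} (σ : EventStream A) :
    σ.norm₁ = (σ.1.map StreamEvent.weight).sum := by
  unfold EventStream.norm₁
  congr 1
  exact List.map_congr_left fun e _ => abs_of_pos e.weight_pos

theorem EventStream.norm₁_nonneg {A : Type*} (σ : EventStream A) : 0 ≤ σ.norm₁ :=
  List.sum_nonneg fun x hx => by
    obtain ⟨e, -, rfl⟩ := List.mem_map.1 hx
    exact abs_nonneg _

/-! ### Event maps dominated by the exponential, and the norm estimates -/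

section EventMaps

variable {A : Type*} [DecidableEq A]

theorem expEventMap_eq_ofLetter (e : StreamEvent A) :
    expEventMap A e = FeatureSpace.ofLetter e.letter fun n => e.weight ^ n / (Nat.factorial n : ℝ) :=
  rfl

/-- Event maps `1 + λ a + ⋯` with coefficients between `0` and those of the exponential. -/
structure IsEventMap (p : StreamEvent A → FeatureSpace A) : Prop where
  nonneg : ∀ e w, 0 ≤ p e w
  le_exp : ∀ e w, p e w ≤ expEventMap A e w
  nil : ∀ e, p e [] = 1
  singleton : ∀ e a, p e [a] = if a = e.letter then e.weight else 0

theorem isEventMap_exp : IsEventMap (expEventMap A) where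
  nonneg e w := by
    have := e.weight_pos
    unfold expEventMap
    split_ifs <;> positivity
  le_exp _ _ := le_rfl
  nil e := by simp [expEventMap]
  singleton e a := by simp [expEventMap]

theorem isEventMap_lin : IsEventMap (linEventMap A) where
  nonneg e w := by
    have := e.weight_pos
    unfold linEventMap
    split_ifs <;> positivity
  le_exp e w := by
    unfold linEventMap
    split_ifs with h1 h2
    · simp [h1, expEventMap]
    · simp [h2, expEventMap]
    · exact isEventMap_exp.nonneg e w
  nil e := by simp [linEventMap]
  singleton e a := by simp [linEventMap]

theorem prod_map_nonneg {p : StreamEvent A → FeatureSpace A} (hp : IsEventMap p)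
    (l : List (StreamEvent A)) (w : List A) : 0 ≤ (l.map p).prod w := by
  induction l generalizing w with
  | nil => cases w <;> simp [FeatureSpace.one_nil, FeatureSpace.one_cons]
  | cons e l ih =>
    rw [List.map_cons, List.prod_cons, FeatureSpace.mul_apply]
    exact Finset.sum_nonneg fun i _ => mul_nonneg (hp.nonneg _ _) (ih _)

theorem prod_map_le_exp {p : StreamEvent A → FeatureSpace A} (hp : IsEventMap p)
    (l : List (StreamEvent A)) (w : List A) :
    (l.map p).prod w ≤ (l.map (expEventMap A)).prod w := by
  induction l generalizing w with
  | nil => exact le_rfl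
  | cons e l ih =>
    rw [List.map_cons, List.prod_cons, FeatureSpace.mul_apply, List.map_cons, List.prod_cons,
      FeatureSpace.mul_apply]
    exact Finset.sum_le_sum fun i _ => mul_le_mul (hp.le_exp _ _) (ih _) (prod_map_nonneg hp _ _)
      (isEventMap_exp.nonneg _ _)

theorem levelSum_prod_map_exp [Fintype A] (l : List (StreamEvent A)) (M : ℕ) :
    (l.map (expEventMap A)).prod.levelSum M =
      (l.map StreamEvent.weight).sum ^ M / (Nat.factorial M : ℝ) := by
  induction l generalizing M with
  | nil =>
    cases M with
    | zero => simp [FeatureSpace.levelSum_zero, FeatureSpace.one_nil]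
    | succ M =>
      rw [FeatureSpace.levelSum_succ]
      simp [FeatureSpace.levelSum, FeatureSpace.tailAt, FeatureSpace.one_cons]
  | cons e l ih =>
    rw [List.map_cons, List.prod_cons, FeatureSpace.levelSum_mul, List.map_cons, List.sum_cons,
      ← sum_pow_div_factorial_mul]
    refine Finset.sum_congr rfl fun i _ => ?_
    rw [ih, expEventMap_eq_ofLetter, FeatureSpace.levelSum_ofLetter]

theorem normLevel_featureMap_exp [Fintype A] (σ : EventStream A) (M : ℕ) :
    (featureMap (expEventMap A) σ).normLevel M = σ.norm₁ ^ M / (Nat.factorial M : ℝ) := by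
  rw [σ.norm₁_eq, ← levelSum_prod_map_exp]
  exact Finset.sum_congr rfl fun w _ => abs_of_nonneg (prod_map_nonneg isEventMap_exp _ _)

theorem normLevel_featureMap_le [Fintype A] {p : StreamEvent A → FeatureSpace A}
    (hp : IsEventMap p) (σ : EventStream A) (M : ℕ) :
    (featureMap p σ).normLevel M ≤ σ.norm₁ ^ M / (Nat.factorial M : ℝ) := by
  rw [← normLevel_featureMap_exp]
  exact Finset.sum_le_sum fun w _ =>
    abs_le_abs_of_nonneg (prod_map_nonneg hp _ _) (prod_map_le_exp hp _ _)

theorem tsum_ofReal_pow_div_factorial {x : ℝ} (hx : 0 ≤ x) :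
    ∑' M : ℕ, ENNReal.ofReal (x ^ M / (Nat.factorial M : ℝ)) = ENNReal.ofReal (Real.exp x) := by
  rw [← ENNReal.ofReal_tsum_of_nonneg (fun n => by positivity) (Real.summable_pow_div_factorial x),
    Real.exp_eq_exp_ℝ, NormedSpace.exp_eq_tsum_div]

theorem norm₁_featureMap_exp [Fintype A] (σ : EventStream A) :
    (featureMap (expEventMap A) σ).norm₁ = ENNReal.ofReal (Real.exp σ.norm₁) := by
  rw [FeatureSpace.norm₁_eq_tsum_normLevel, ← tsum_ofReal_pow_div_factorial σ.norm₁_nonneg]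
  simp only [normLevel_featureMap_exp]

theorem norm₁_featureMap_le [Fintype A] {p : StreamEvent A → FeatureSpace A}
    (hp : IsEventMap p) (σ : EventStream A) :
    (featureMap p σ).norm₁ ≤ ENNReal.ofReal (Real.exp σ.norm₁) := by
  rw [FeatureSpace.norm₁_eq_tsum_normLevel, ← tsum_ofReal_pow_div_factorial σ.norm₁_nonneg]
  exact ENNReal.tsum_le_tsum fun M => ENNReal.ofReal_le_ofReal (normLevel_featureMap_le hp σ M)

/-- A coefficient is at most its level sum, which is one term of an exponential series. This bounds
all prefix products uniformly. -/
theorem prod_map_le_exp_sum [Fintype A] {p : StreamEvent A → FeatureSpace A} (hp : IsEventMap p)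
    (l : List (StreamEvent A)) (w : List A) :
    (l.map p).prod w ≤ Real.exp (l.map StreamEvent.weight).sum := by
  refine (prod_map_le_exp hp l w).trans
    ((FeatureSpace.le_levelSum (prod_map_nonneg isEventMap_exp l) w).trans ?_)
  rw [levelSum_prod_map_exp]
  refine Real.pow_div_factorial_le_exp _ (List.sum_nonneg fun x hx => ?_) _
  obtain ⟨e, -, rfl⟩ := List.mem_map.1 hx
  exact e.weight_pos.le

/-- Multiplying by one more event changes the coefficients to first order by the letter of the
event; the remainder is quadratic in its weight. -/
theorem abs_mul_eventMap_sub_le {p : StreamEvent A → FeatureSpace A} (hp : IsEventMap p)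
    {f : FeatureSpace A} {B : ℝ} (hf : ∀ w, 0 ≤ f w) (hfB : ∀ w, f w ≤ B) (e : StreamEvent A)
    (heB : Real.exp e.weight ≤ B) (w : List A) (a : A) :
    |(f * p e) (w ++ [a]) - f (w ++ [a]) - f w * (if a = e.letter then e.weight else 0)| ≤
      w.length * B ^ 2 * e.weight ^ 2 := by
  have hB : 0 ≤ B := (hf []).trans (hfB [])
  have hpos := e.weight_pos
  have hrest : ∀ i ∈ Finset.range w.length, 0 ≤ f ((w ++ [a]).take i) * p e ((w ++ [a]).drop i) ∧
      f ((w ++ [a]).take i) * p e ((w ++ [a]).drop i) ≤ B ^ 2 * e.weight ^ 2 := by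
    -- These cuts leave at least two letters to `p e`, which gives the factor `e.weight ^ 2`.
    intro i hi
    refine ⟨mul_nonneg (hf _) (hp.nonneg _ _), ?_⟩
    have hlen : ∃ k, ((w ++ [a]).drop i).length = k + 2 := by
      refine ⟨w.length - 1 - i, ?_⟩
      have := Finset.mem_range.1 hi
      simp only [List.length_drop, List.length_append, List.length_singleton]
      omega
    obtain ⟨k, hk⟩ := hlen
    have h1 : p e ((w ++ [a]).drop i) ≤ e.weight ^ (k + 2) / (Nat.factorial (k + 2) : ℝ) := by
      refine (hp.le_exp _ _).trans ?_
      unfold expEventMap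
      split_ifs
      · rw [hk]
      · positivity
    have h2 : e.weight ^ (k + 2) / (Nat.factorial (k + 2) : ℝ) ≤ e.weight ^ 2 * B := by
      -- Weakening `(k + 2)!` to `k!` splits off the square and leaves a term of the exponential
      -- series.
      calc e.weight ^ (k + 2) / (Nat.factorial (k + 2) : ℝ)
          ≤ e.weight ^ (k + 2) / (Nat.factorial k : ℝ) := by
            gcongr
            omega
        _ = e.weight ^ 2 * (e.weight ^ k / (Nat.factorial k : ℝ)) := by ring
        _ ≤ e.weight ^ 2 * B := by
            gcongr
            exact (Real.pow_div_factorial_le_exp _ hpos.le _).trans heB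
    calc f ((w ++ [a]).take i) * p e ((w ++ [a]).drop i) ≤ B * (e.weight ^ 2 * B) :=
          mul_le_mul (hfB _) (h1.trans h2) (hp.nonneg _ _) hB
      _ = B ^ 2 * e.weight ^ 2 := by ring
  -- The last two cuts leave `[a]` and `[]` to `p e`: exactly the two subtracted terms.
  have heq : (f * p e) (w ++ [a]) - f (w ++ [a]) - f w * (if a = e.letter then e.weight else 0) =
      ∑ i ∈ Finset.range w.length, f ((w ++ [a]).take i) * p e ((w ++ [a]).drop i) := by
    rw [FeatureSpace.mul_apply, List.length_append, List.length_singleton, Finset.sum_range_succ,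
      Finset.sum_range_succ, ← hp.singleton]
    have h1 : (w ++ [a]).take (w.length + 1) = w ++ [a] := List.take_of_length_le (by simp)
    have h2 : (w ++ [a]).drop (w.length + 1) = [] := List.drop_of_length_le (by simp)
    rw [h1, h2, List.take_left, List.drop_left, hp.nil]
    ring
  rw [heq, abs_of_nonneg (Finset.sum_nonneg fun i hi => (hrest i hi).1)]
  refine (Finset.sum_le_sum fun i hi => (hrest i hi).2).trans ?_
  rw [Finset.sum_const, Finset.card_range, nsmul_eq_mul, mul_assoc]

end EventMaps

/-! ### The coproduct is multiplicative -/

theorem wordPairing_add {A : Type*} (k l : List A →₀ ℝ) (f : FeatureSpace A) :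
    wordPairing (k + l) f = wordPairing k f + wordPairing l f :=
  Finsupp.sum_add_index' (fun _ => zero_mul _) fun _ _ _ => add_mul _ _ _

theorem wordPairing_single {A : Type*} (w : List A) (f : FeatureSpace A) :
    wordPairing (Finsupp.single w 1) f = f w := by
  simp [wordPairing]

theorem wordPairing_mapDomain_cons {A : Type*} (a : A) (l : List A →₀ ℝ) (f : FeatureSpace A) :
    wordPairing (l.mapDomain (List.cons a)) f = wordPairing l (f.tailAt a) :=
  Finsupp.sum_mapDomain_index (fun _ => zero_mul _) fun _ _ _ => add_mul _ _ _

namespace FeatureSpace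

variable {A : Type*}

theorem coproduct_nil_left (f : FeatureSpace A) (v : List A) : f.coproduct [] v = f v := by
  rw [coproduct, shuffle, wordPairing_single]

theorem coproduct_nil_right (f : FeatureSpace A) (u : List A) : f.coproduct u [] = f u := by
  cases u with
  | nil => exact coproduct_nil_left f []
  | cons a u => rw [coproduct, shuffle, wordPairing_single]

theorem coproduct_cons_cons (f : FeatureSpace A) (a b : A) (u v : List A) :
    f.coproduct (a :: u) (b :: v) =
      (f.tailAt a).coproduct u (b :: v) + (f.tailAt b).coproduct (a :: u) v := by
  rw [coproduct, shuffle, wordPairing_add, wordPairing_mapDomain_cons, wordPairing_mapDomain_cons]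
  rfl

/-- The shape `c * g + h` is that of the tails of a product in `mul_cons`. -/
theorem coproduct_linear {f g h : FeatureSpace A} {c : ℝ} (hf : ∀ w, f w = c * g w + h w)
    (u v : List A) : f.coproduct u v = c * g.coproduct u v + h.coproduct u v := by
  simp only [coproduct, wordPairing, Finsupp.sum, hf, Finset.mul_sum, ← Finset.sum_add_distrib]
  exact Finset.sum_congr rfl fun w _ => by ring

theorem coproduct_mul (g : FeatureSpace A) (u v : List A) (f : FeatureSpace A) :
    (f * g).coproduct u v = ∑ i ∈ Finset.range (u.length + 1), ∑ j ∈ Finset.range (v.length + 1),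
      f.coproduct (u.take i) (v.take j) * g.coproduct (u.drop i) (v.drop j) := by
  induction u generalizing v f with
  | nil => simp [coproduct_nil_left, mul_apply]
  | cons a u ihu =>
    induction v generalizing f with
    | nil => simp [coproduct_nil_right, mul_apply]
    | cons b v ihv =>
      have h : ∀ c w, (f * g).tailAt c w = f [] * g.tailAt c w + (f.tailAt c * g) w :=
        fun c w => mul_cons f g c w
      rw [coproduct_cons_cons, coproduct_linear (h a), coproduct_linear (h b), ihu, ihv]
      simp only [List.length_cons]
      -- Cuts with `i = 0` or `j = 0` are split off; on all others both prefixes start with a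
      -- letter, and the shuffle recursion applies to them.
      rw [Finset.sum_range_succ' _ (u.length + 1), Finset.sum_range_succ' _ (u.length + 1)]
      simp only [Finset.sum_range_succ' _ (v.length + 1), List.take_succ_cons, List.drop_succ_cons,
        List.take_zero, List.drop_zero, coproduct_cons_cons, coproduct_nil_left,
        coproduct_nil_right, add_mul, Finset.sum_add_distrib, tailAt]
      ring

theorem IsGroupLike.mul {f g : FeatureSpace A} (hf : f.IsGroupLike) (hg : g.IsGroupLike) :
    (f * g).IsGroupLike := by
  refine ⟨?_, ?_⟩
  · have hf1 := hf.1
    have hg1 := hg.1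
    rw [counit] at hf1 hg1 ⊢
    rw [mul_nil, hf1, hg1, one_mul]
  · funext u v
    rw [coproduct_mul, hf.2, hg.2, tensor, mul_apply, mul_apply, Finset.sum_mul_sum]
    exact Finset.sum_congr rfl fun i _ => Finset.sum_congr rfl fun j _ => by
      simp only [tensor]
      ring

theorem isGroupLike_one : (1 : FeatureSpace A).IsGroupLike := by
  have key : ∀ (u v : List A), coproduct (fun _ => 0) u v = 0 := by
    intro u v
    simp [coproduct, wordPairing]
  refine ⟨rfl, ?_⟩
  funext u v
  cases u with
  | nil => rw [coproduct_nil_left, tensor, one_nil, one_mul]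
  | cons a u =>
    cases v with
    | nil => rw [coproduct_nil_right, tensor, one_nil, mul_one]
    | cons b v =>
      rw [coproduct_cons_cons, tensor, one_cons, zero_mul]
      exact (congrArg₂ (· + ·) (key _ _) (key _ _)).trans (add_zero 0)

/-- For powers of one letter the shuffle recursion is Pascal's rule. -/
theorem coproduct_ofLetter [DecidableEq A] (x : A) (u v : List A) (c : ℕ → ℝ) :
    (ofLetter x c).coproduct u v = if (∀ b ∈ u, b = x) ∧ ∀ b ∈ v, b = x then
      ((u.length + v.length).choose u.length : ℝ) * c (u.length + v.length) else 0 := by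
  induction u generalizing v c with
  | nil => simp [coproduct_nil_left, ofLetter_apply]
  | cons a u ihu =>
    induction v generalizing c with
    | nil => simp [coproduct_nil_right, ofLetter_apply]
    | cons b v ihv =>
      rw [coproduct_cons_cons, tailAt_ofLetter, tailAt_ofLetter, ihu, ihv]
      by_cases hu : ∀ b ∈ u, b = x <;> by_cases hv : ∀ b ∈ v, b = x <;> by_cases ha : a = x <;>
        by_cases hb : b = x <;> simp [hu, hv, ha, hb]
      have h1 : u.length + 1 + v.length = u.length + (v.length + 1) := by omega
      have h2 : u.length + 1 + (v.length + 1) = u.length + (v.length + 1) + 1 := by omega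
      simp only [if_pos (And.intro hu hv), h1, h2, Nat.choose_succ_succ]
      push_cast
      rw [Nat.succ_eq_add_one]
      ring

theorem isGroupLike_expEventMap [DecidableEq A] (e : StreamEvent A) :
    (expEventMap A e).IsGroupLike := by
  refine ⟨isEventMap_exp.nil e, ?_⟩
  funext u v
  rw [tensor, expEventMap_eq_ofLetter, coproduct_ofLetter, ofLetter_apply, ofLetter_apply]
  by_cases hu : ∀ b ∈ u, b = e.letter
  · by_cases hv : ∀ b ∈ v, b = e.letter
    · rw [if_pos ⟨hu, hv⟩, if_pos hu, if_pos hv, Nat.cast_choose ℝ (Nat.le_add_right _ _),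
        Nat.add_sub_cancel_left]
      have := Nat.factorial_ne_zero (u.length + v.length)
      have := Nat.factorial_ne_zero u.length
      have := Nat.factorial_ne_zero v.length
      field_simp
      exact pow_add _ _ _
    · rw [if_neg fun h => hv h.2, if_neg hv, mul_zero]
  · rw [if_neg fun h => hu h.1, if_neg hu, zero_mul]

theorem isGroupLike_featureMap_exp [DecidableEq A] (σ : EventStream A) :
    (featureMap (expEventMap A) σ).IsGroupLike := by
  unfold featureMap
  generalize σ.1 = l
  induction l with
  | nil => exact isGroupLike_one
  | cons e l ih =>
    rw [List.map_cons, List.prod_cons]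
    exact (isGroupLike_expEventMap e).mul ih

/-- Being group-like is closed under coordinatewise limits. -/
theorem IsGroupLike.of_tendsto {f : ℕ → FeatureSpace A} {g : FeatureSpace A}
    (hf : ∀ n, (f n).IsGroupLike) (h : ∀ w, Tendsto (fun n => f n w) atTop (𝓝 (g w))) :
    g.IsGroupLike := by
  refine ⟨?_, ?_⟩
  · exact tendsto_nhds_unique (h []) (tendsto_const_nhds.congr fun n => (hf n).1.symm)
  · funext u v
    have h1 : Tendsto (fun n => (f n).coproduct u v) atTop (𝓝 (g.coproduct u v)) :=
      tendsto_finsetSum _ fun w _ => (h w).const_mul _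
    refine tendsto_nhds_unique h1 (((h u).mul (h v)).congr fun n => ?_)
    rw [(hf n).2, tensor]

end FeatureSpace

/-! ### Integration against continuous paths of bounded variation -/

section StieltjesIntegral

open Set VectorMeasure

theorem SignedMeasure.isFiniteMeasure_variation {X : Type*} [MeasurableSpace X]
    (μ : SignedMeasure X) : IsFiniteMeasure μ.variation := by
  rw [← SignedMeasure.totalVariation_eq_variation]
  infer_instance

variable {μ : SignedMeasure unitInterval}

theorem integrable_of_continuous {F : unitInterval → ℝ} (hF : Continuous F) :
    μ.Integrable F := by
  have := SignedMeasure.isFiniteMeasure_variation μ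
  exact hF.integrable_of_hasCompactSupport (HasCompactSupport.of_compactSpace F)

/-- Dominated convergence: as `t → t₀`, the indicators of `[0, t]` converge off `t₀`, which is a
null point of the variation. -/
theorem continuous_setIntegral_Icc (hμ : ∀ t, μ {t} = 0) {F : unitInterval → ℝ}
    (hF : Continuous F) : Continuous fun t => ∫ᵛ s in Icc 0 t, F s ∂•μ := by
  have := SignedMeasure.isFiniteMeasure_variation μ
  simp only [← VectorMeasure.integral_indicator measurableSet_Icc]
  refine continuous_iff_continuousAt.2 fun t₀ => ?_
  refine continuousAt_of_dominated (bound := fun x => ‖F x‖)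
    (Eventually.of_forall fun t => (hF.aestronglyMeasurable).indicator measurableSet_Icc)
    (Eventually.of_forall fun t => Eventually.of_forall fun x => norm_indicator_le_norm_self _ _)
    (integrable_of_continuous hF).norm ?_
  have h0 : μ.variation {t₀} = 0 := by
    rw [variation_apply_eq_zero (measurableSet_singleton t₀)]
    intro s hs _
    rcases subset_singleton_iff_eq.1 hs with rfl | rfl
    · simp
    · exact hμ t₀
  filter_upwards [measure_eq_zero_iff_ae_notMem.1 h0] with x hx
  rcases lt_or_gt_of_ne (show x ≠ t₀ from hx) with h | h
  · refine (continuousAt_const (y := F x)).congr ?_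
    filter_upwards [lt_mem_nhds h] with t ht
    rw [indicator_of_mem (show x ∈ Icc 0 t from ⟨unitInterval.nonneg', ht.le⟩)]
  · refine (continuousAt_const (y := (0 : ℝ))).congr ?_
    filter_upwards [gt_mem_nhds h] with t ht
    rw [indicator_of_notMem fun h' : x ∈ Icc 0 t => absurd h'.2 (not_le.2 ht)]

theorem setIntegral_Icc_add_Ioc {F : unitInterval → ℝ} (hF : Continuous F) {s t : unitInterval}
    (hst : s ≤ t) :
    ∫ᵛ x in Icc 0 t, F x ∂•μ = ∫ᵛ x in Icc 0 s, F x ∂•μ + ∫ᵛ x in Ioc s t, F x ∂•μ := by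
  have hi : μ.Integrable F := integrable_of_continuous hF
  rw [← setIntegral_union ?_ measurableSet_Icc measurableSet_Ioc hi.integrableOn hi.integrableOn,
    Icc_union_Ioc_eq_Icc unitInterval.nonneg' hst]
  exact disjoint_left.2 fun x hx hx' => absurd hx.2 (not_le.2 hx'.1)

theorem abs_setIntegral_Ioc_sub_le {F : unitInterval → ℝ} (hF : Continuous F) (s t : unitInterval)
    {c δ : ℝ} (hc : ∀ x ∈ Ioc s t, |F x - c| ≤ δ) :
    |∫ᵛ x in Ioc s t, F x ∂•μ - c * μ (Ioc s t)| ≤ δ * μ.variation.real (Ioc s t) := by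
  have := SignedMeasure.isFiniteMeasure_variation μ
  have hi : μ.Integrable F := integrable_of_continuous hF
  have hi' : μ.Integrable fun _ => c := integrable_of_continuous continuous_const
  have h1 : ∫ᵛ x in Ioc s t, c ∂•μ = c * μ (Ioc s t) := by
    rw [VectorMeasure.setIntegral_const]
    rfl
  rw [← h1, ← integral_fun_sub hi.restrict hi'.restrict, ← Real.norm_eq_abs]
  refine norm_integral_le_integral_norm.trans ?_
  rw [variation_restrict measurableSet_Ioc]
  have h2 : ∫ x in Ioc s t, ‖F x - c‖ ∂μ.variation ≤ ∫ x in Ioc s t, δ ∂μ.variation :=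
    setIntegral_mono_on ((hi.sub hi').norm.integrableOn) (integrable_const _) measurableSet_Ioc hc
  rw [MeasureTheory.setIntegral_const, smul_eq_mul, mul_comm] at h2
  -- The extra factor is the operator norm of scalar multiplication, at most `1`.
  refine (mul_le_of_le_one_left (integral_nonneg fun _ => norm_nonneg _) ?_).trans h2
  exact ContinuousLinearMap.opNorm_lsmul_le

theorem variation_real_Icc_add_Ioc {s t : unitInterval} (hst : s ≤ t) :
    μ.variation.real (Icc 0 t) = μ.variation.real (Icc 0 s) + μ.variation.real (Ioc s t) := by
  have := SignedMeasure.isFiniteMeasure_variation μ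
  rw [← measureReal_union _ measurableSet_Ioc, Icc_union_Ioc_eq_Icc unitInterval.nonneg' hst]
  exact disjoint_left.2 fun x hx hx' => absurd hx.2 (not_le.2 hx'.1)

/-- Comparison of an integral with a sequence that satisfies the corresponding difference equation
up to errors `r`, with the increments of `h` in place of the measures of the intervals. -/
theorem abs_sub_setIntegral_le {F : unitInterval → ℝ} (hF : Continuous F) (hμ : μ {0} = 0)
    {x : ℕ → unitInterval} (hx : Monotone x) (hx0 : x 0 = 0) {u v h r : ℕ → ℝ} {K δ : ℝ}
    (hv : v 0 = 0) (k : ℕ) (hK : ∀ i < k, |u i| ≤ K) (hu : ∀ i < k, |u i - F (x i)| ≤ δ)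
    (hFx : ∀ i < k, ∀ y ∈ Ioc (x i) (x (i + 1)), |F y - F (x i)| ≤ δ)
    (hr : ∀ i < k, |v (i + 1) - v i - u i * (h (i + 1) - h i)| ≤ r i) :
    |v k - ∫ᵛ s in Icc 0 (x k), F s ∂•μ| ≤
      K * ∑ i ∈ Finset.range k, |h (i + 1) - h i - μ (Ioc (x i) (x (i + 1)))| +
        2 * δ * μ.variation.real (Icc 0 (x k)) + ∑ i ∈ Finset.range k, r i := by
  have := SignedMeasure.isFiniteMeasure_variation μ
  induction k with
  | zero =>
    have h0 : ∫ᵛ s in Icc 0 (0 : unitInterval), F s ∂•μ = 0 := by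
      rw [Icc_self, VectorMeasure.integral_singleton, hμ, _root_.map_zero]
    have h1 : μ.variation.real (Icc 0 (0 : unitInterval)) = 0 := by
      rw [Icc_self, measureReal_def, (variation_apply_eq_zero (measurableSet_singleton _)).2]
      · rfl
      · intro s hs _
        rcases subset_singleton_iff_eq.1 hs with rfl | rfl
        · simp
        · exact hμ
    rw [hv, hx0, h0, h1]
    simp
  | succ k ih =>
    have ih' := ih (fun i hi => hK i (by omega)) (fun i hi => hu i (by omega))
      (fun i hi => hFx i (by omega)) (fun i hi => hr i (by omega))
    have hle : x k ≤ x (k + 1) := hx (Nat.le_succ k)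
    rw [setIntegral_Icc_add_Ioc hF hle, variation_real_Icc_add_Ioc hle, Finset.sum_range_succ,
      Finset.sum_range_succ]
    set J := Ioc (x k) (x (k + 1))
    set V := μ.variation.real J
    -- With `Δ` for the increment from `k` to `k + 1`, the new error is the sum of `Δv - u Δh`, `u
    -- (Δh - μ J)`, `(u - F (x k)) μ J` and `F (x k) μ J - ∫_J F`; the last two account for `2 * δ`.
    have e1 : |∫ᵛ s in J, F s ∂•μ - F (x k) * μ J| ≤ δ * V :=
      abs_setIntegral_Ioc_sub_le hF _ _ (hFx k (by omega))
    have e2 : |u k * (h (k + 1) - h k - μ J)| ≤ K * |h (k + 1) - h k - μ J| := by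
      rw [abs_mul]
      exact mul_le_mul_of_nonneg_right (hK k (by omega)) (abs_nonneg _)
    have e3 : |(u k - F (x k)) * μ J| ≤ δ * V := by
      rw [abs_mul]
      exact mul_le_mul (hu k (by omega))
        (norm_measure_le_variation (measure_ne_top μ.variation J)) (abs_nonneg _)
        ((abs_nonneg _).trans (hu k (by omega)))
    have e4 := hr k (by omega)
    rw [abs_le] at *
    constructor <;> linarith [e1.1, e1.2, e2.1, e2.2, e3.1, e3.2, e4.1, e4.2, ih'.1, ih'.2]

end StieltjesIntegral

/-! ### Iterated integrals along a continuous path -/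

section IteratedIntegrals

variable {A : Type*} [Fintype A] {γ : unitInterval → EuclideanSpace ℝ A}
  (hγ : BoundedVariationOn γ Set.univ)

theorem coordMeasure_singleton (hc : Continuous γ) (a : A) (t : unitInterval) :
    coordMeasure γ hγ a {t} = 0 := by
  have h : Continuous fun t => γ t a := by fun_prop
  rw [coordMeasure, BoundedVariationOn.vectorMeasure_singleton,
    h.continuousWithinAt.rightLim_eq, h.continuousWithinAt.leftLim_eq, sub_self]

theorem coordMeasure_Ioc (hc : Continuous γ) (a : A) {s t : unitInterval} (hst : s ≤ t) :
    coordMeasure γ hγ a (Set.Ioc s t) = γ t a - γ s a := by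
  have h : Continuous fun t => γ t a := by fun_prop
  rw [coordMeasure, BoundedVariationOn.vectorMeasure_Ioc _ hst,
    h.continuousWithinAt.rightLim_eq, h.continuousWithinAt.rightLim_eq]

theorem iteratedIntegralTo_append_singleton (w : List A) (a : A) (t : unitInterval) :
    iteratedIntegralTo γ hγ (w ++ [a]) t =
      ∫ᵛ s in Set.Icc 0 t, iteratedIntegralTo γ hγ w s ∂•(coordMeasure γ hγ a) := by
  simp [iteratedIntegralTo]

theorem continuous_iteratedIntegralTo (hc : Continuous γ) (w : List A) :
    Continuous (iteratedIntegralTo γ hγ w) := by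
  induction w using List.reverseRecOn with
  | nil => exact continuous_const
  | append_singleton w a ih =>
    have := continuous_setIntegral_Icc (coordMeasure_singleton hγ hc a) ih
    exact this.congr fun t => (iteratedIntegralTo_append_singleton hγ w a t).symm

end IteratedIntegrals

/-! ### Lattice paths -/

/-- The point `k / N` of the unit interval (and `1` for `k ≥ N ≥ 1`). -/
def gridPoint (N k : ℕ) : unitInterval := Set.projIcc 0 1 zero_le_one ((k : ℝ) / N)

theorem coe_gridPoint {N k : ℕ} (h : k ≤ N) : (gridPoint N k : ℝ) = k / N := by
  have h' : (k : ℝ) / N ∈ Set.Icc (0 : ℝ) 1 :=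
    ⟨by positivity, div_le_one_of_le₀ (by exact_mod_cast h) (by positivity)⟩
  rw [gridPoint, Set.projIcc_of_mem zero_le_one h']

theorem gridPoint_zero (N : ℕ) : gridPoint N 0 = 0 :=
  Subtype.ext ((coe_gridPoint (Nat.zero_le N)).trans (by simp))

theorem gridPoint_self {N : ℕ} (hN : N ≠ 0) : gridPoint N N = 1 :=
  Subtype.ext ((coe_gridPoint le_rfl).trans (by simp [hN]))

theorem monotone_gridPoint (N : ℕ) : Monotone (gridPoint N) := fun i j hij =>
  Set.monotone_projIcc _ (by gcongr)

theorem dist_gridPoint_le {N i : ℕ} (hi : i < N) {y : unitInterval}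
    (hy : y ∈ Set.Icc (gridPoint N i) (gridPoint N (i + 1))) :
    dist y (gridPoint N i) ≤ 1 / N := by
  have h1 : (gridPoint N i : ℝ) ≤ y := hy.1
  have h2 : (y : ℝ) ≤ gridPoint N (i + 1) := hy.2
  rw [Subtype.dist_eq, Real.dist_eq, abs_of_nonneg (sub_nonneg.2 h1)]
  rw [coe_gridPoint hi.le] at h1 ⊢
  rw [coe_gridPoint (Nat.succ_le_of_lt hi)] at h2
  push_cast at h2
  rw [add_div] at h2
  linarith

namespace EventStream

theorem length_pos {A : Type*} (σ : EventStream A) : 0 < σ.length := List.length_pos_iff.2 σ.2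

variable {A : Type*} [Fintype A] [DecidableEq A] (σ : EventStream A)

theorem stepVector_of_lt {i : ℕ} (h : i < σ.1.length) :
    σ.stepVector i = EuclideanSpace.single (σ.1[i]).letter (σ.1[i]).weight := dif_pos h

theorem norm_stepVector_of_lt {i : ℕ} (h : i < σ.1.length) :
    ‖σ.stepVector i‖ = |(σ.1[i]).weight| := by
  rw [stepVector_of_lt σ h, PiLp.norm_single, Real.norm_eq_abs]

theorem stepVector_apply_nonneg (i : ℕ) (a : A) : 0 ≤ σ.stepVector i a := by
  unfold stepVector
  split_ifs with h
  · have := (σ.1[i]).weight_pos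
    rw [PiLp.single_apply]
    split_ifs <;> positivity
  · simp

theorem sum_stepVector_apply (i : ℕ) : ∑ a, σ.stepVector i a = ‖σ.stepVector i‖ := by
  by_cases h : i < σ.1.length
  · rw [norm_stepVector_of_lt σ h, stepVector_of_lt σ h, abs_of_pos (σ.1[i]).weight_pos]
    simp
  · simp [stepVector, h]

theorem norm₁_eq_sum_norm_stepVector :
    σ.norm₁ = ∑ i ∈ Finset.range σ.length, ‖σ.stepVector i‖ := by
  rw [Finset.sum_range, norm₁, ← Fin.sum_univ_fun_getElem]
  exact Finset.sum_congr rfl fun i _ => (norm_stepVector_of_lt σ i.2).symm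

/-- Allowing both `x = 0` and `x = 1` gives one affine formula for a whole closed cell, although the
floor jumps at its right end. -/
theorem path_eq {t : unitInterval} {q : ℕ} {x : ℝ} (hx0 : 0 ≤ x) (hx1 : x ≤ 1)
    (h : (t : ℝ) * σ.length = q + x) :
    σ.path t = x • σ.stepVector q + ∑ i ∈ Finset.range q, σ.stepVector i := by
  rw [path, h]
  rcases hx1.lt_or_eq with hx | rfl
  · have h1 : ⌊(q : ℝ) + x⌋₊ = q := by
      rw [add_comm, Nat.floor_add_natCast hx0, Nat.floor_eq_zero.2 hx, zero_add]
    rw [h1, add_comm (q : ℝ) x, Int.fract_add_natCast, Int.fract_eq_self.2 ⟨hx0, hx⟩]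
  · have h1 : (q : ℝ) + 1 = ((q + 1 : ℕ) : ℝ) := by push_cast; rfl
    rw [h1, Nat.floor_natCast, Int.fract_natCast, zero_smul, zero_add, one_smul,
      Finset.sum_range_succ, add_comm]

theorem path_gridPoint {k : ℕ} (hk : k ≤ σ.length) :
    σ.path (gridPoint σ.length k) = ∑ i ∈ Finset.range k, σ.stepVector i := by
  have hL : (σ.length : ℝ) ≠ 0 := by exact_mod_cast σ.length_pos.ne'
  rw [σ.path_eq (q := k) le_rfl zero_le_one, zero_smul, zero_add]
  rw [coe_gridPoint hk, div_mul_cancel₀ _ hL, add_zero]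

theorem path_gridPoint_succ_sub {i : ℕ} (hi : i < σ.length) :
    σ.path (gridPoint σ.length (i + 1)) - σ.path (gridPoint σ.length i) = σ.stepVector i := by
  rw [path_gridPoint σ hi, path_gridPoint σ hi.le, Finset.sum_range_succ, add_sub_cancel_left]

/-- The fine cell `j` lies in the coarse cell `j / m`, where the path is affine; its ends have
relative positions `(j % m) / m` and `(j % m + 1) / m`. -/
theorem path_mul_gridPoint_succ_sub {m : ℕ} (hm : m ≠ 0) {j : ℕ} (hj : j < σ.length * m) :
    σ.path (gridPoint (σ.length * m) (j + 1)) - σ.path (gridPoint (σ.length * m) j) =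
      (1 / m : ℝ) • σ.stepVector (j / m) := by
  have hL : (σ.length : ℝ) ≠ 0 := by exact_mod_cast σ.length_pos.ne'
  have hm' : (0 : ℝ) < m := by exact_mod_cast Nat.pos_of_ne_zero hm
  have hj' : (j : ℝ) = m * (j / m : ℕ) + (j % m : ℕ) := by exact_mod_cast (Nat.div_add_mod j m).symm
  have hr : ((j % m : ℕ) : ℝ) + 1 ≤ m := by
    exact_mod_cast Nat.mod_lt j (Nat.pos_of_ne_zero hm)
  have hr0 : (0 : ℝ) ≤ (j % m : ℕ) := Nat.cast_nonneg _
  rw [σ.path_eq (q := j / m) (x := ((j % m : ℕ) + 1) / m) (by positivity)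
      ((div_le_one hm').2 hr),
    σ.path_eq (q := j / m) (x := (j % m : ℕ) / m) (by positivity)
      ((div_le_one hm').2 (by linarith)), add_div, add_smul]
  · abel
  · rw [coe_gridPoint hj.le, hj']
    push_cast
    field_simp
  · rw [coe_gridPoint hj]
    push_cast
    rw [hj']
    field_simp
    ring

theorem path_apply (t : unitInterval) (a : A) : σ.path t a =
    Int.fract ((t : ℝ) * σ.length) * σ.stepVector ⌊(t : ℝ) * σ.length⌋₊ a
      + ∑ i ∈ Finset.range ⌊(t : ℝ) * σ.length⌋₊, σ.stepVector i a := by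
  simp [path]

theorem monotone_path_apply (a : A) : Monotone fun t => σ.path t a := by
  intro s t hst
  have hs : (0 : ℝ) ≤ s * σ.length := mul_nonneg s.2.1 (Nat.cast_nonneg _)
  have hst' : (s : ℝ) * σ.length ≤ t * σ.length :=
    mul_le_mul_of_nonneg_right hst (Nat.cast_nonneg _)
  have ht := hs.trans hst'
  simp only [path_apply]
  generalize (s : ℝ) * σ.length = x at *
  generalize (t : ℝ) * σ.length = y at *
  -- Either both times share a cell, or the vertex `⌊x⌋₊ + 1` separates them.
  rcases (Nat.floor_mono hst').eq_or_lt with h | h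
  · have hfract : Int.fract x ≤ Int.fract y := by
      rw [Int.fract, Int.fract, ← natCast_floor_eq_intCast_floor hs,
        ← natCast_floor_eq_intCast_floor ht, h]
      linarith
    rw [h]
    gcongr
    exact σ.stepVector_apply_nonneg _ a
  · calc Int.fract x * σ.stepVector ⌊x⌋₊ a + ∑ i ∈ Finset.range ⌊x⌋₊, σ.stepVector i a
        ≤ ∑ i ∈ Finset.range (⌊x⌋₊ + 1), σ.stepVector i a := by
          rw [Finset.sum_range_succ, add_comm]
          gcongr
          exact mul_le_of_le_one_left (σ.stepVector_apply_nonneg _ a) (Int.fract_lt_one x).le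
      _ ≤ ∑ i ∈ Finset.range ⌊y⌋₊, σ.stepVector i a :=
          Finset.sum_le_sum_of_subset_of_nonneg (Finset.range_mono h)
            fun i _ _ => σ.stepVector_apply_nonneg i a
      _ ≤ _ := le_add_of_nonneg_left
          (mul_nonneg (Int.fract_nonneg y) (σ.stepVector_apply_nonneg _ a))

/-- The increment has non-negative coordinates, and the Euclidean norm is at most the sum of these.
-/
theorem norm_path_sub_le {s t : unitInterval} (hst : s ≤ t) :
    ‖σ.path t - σ.path s‖ ≤ ∑ a, σ.path t a - ∑ a, σ.path s a := by
  have h : ∀ a, 0 ≤ (σ.path t - σ.path s) a := fun a => sub_nonneg.2 (σ.monotone_path_apply a hst)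
  rw [← Finset.sum_sub_distrib, EuclideanSpace.norm_eq]
  refine Real.sqrt_le_iff.2 ⟨Finset.sum_nonneg fun a _ => h a, ?_⟩
  simp only [Real.norm_eq_abs, sq_abs]
  exact Finset.sum_sq_le_sq_sum_of_nonneg fun a _ => h a

/-- The total variation of the lattice path of a stream. -/
theorem eVariationOn_path : eVariationOn σ.path Set.univ = ENNReal.ofReal σ.norm₁ := by
  have hℓ : Monotone fun t => ∑ a, σ.path t a := fun s t hst =>
    Finset.sum_le_sum fun a _ => σ.monotone_path_apply a hst
  have htotal : ∑ a, σ.path 1 a - ∑ a, σ.path 0 a = σ.norm₁ := by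
    rw [← gridPoint_self σ.length_pos.ne', ← gridPoint_zero σ.length, path_gridPoint σ le_rfl,
      path_gridPoint σ (Nat.zero_le _), norm₁_eq_sum_norm_stepVector]
    simp only [Finset.range_zero, Finset.sum_empty, PiLp.zero_apply, WithLp.ofLp_sum,
      Finset.sum_apply, Finset.sum_const_zero, sub_zero]
    rw [Finset.sum_comm]
    exact Finset.sum_congr rfl fun i _ => σ.sum_stepVector_apply i
  have hvar : eVariationOn (fun t => ∑ a, σ.path t a) Set.univ = ENNReal.ofReal σ.norm₁ := by
    have h := (hℓ.monotoneOn Set.univ).eVariationOn_eq (Set.mem_univ 0) (Set.mem_univ 1)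
    have h' : (Set.Icc 0 1 : Set unitInterval) = Set.univ :=
      Set.eq_univ_of_forall fun t => ⟨unitInterval.nonneg', unitInterval.le_one'⟩
    rw [h', Set.univ_inter, htotal] at h
    exact h
  refine le_antisymm ?_ ?_
  · rw [← hvar]
    refine iSup_le fun p => ?_
    refine (Finset.sum_le_sum fun i _ => ?_).trans (eVariationOn.sum_le p.2.2.1 p.2.2.2)
    rw [edist_dist, edist_dist, dist_eq_norm]
    refine ENNReal.ofReal_le_ofReal ((σ.norm_path_sub_le (p.2.2.1 (Nat.le_succ i))).trans ?_)
    exact le_abs_self _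
  -- The partition into the cells of the grid attains the bound.
  · refine le_trans (le_of_eq ?_)
      (eVariationOn.sum_le (monotone_gridPoint σ.length) (n := σ.length) fun _ => Set.mem_univ _)
    rw [norm₁_eq_sum_norm_stepVector, ENNReal.ofReal_sum_of_nonneg fun _ _ => norm_nonneg _]
    refine Finset.sum_congr rfl fun i hi => ?_
    rw [edist_dist, dist_eq_norm, path_gridPoint_succ_sub σ (Finset.mem_range.1 hi)]

end EventStream

/-! ### Subdivision of streams -/

/-- The event with weight `λ / m`. -/
def StreamEvent.divNat {A : Type*} (e : StreamEvent A) (m : ℕ) (hm : 0 < m) : StreamEvent A where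
  weight := e.weight / m
  letter := e.letter
  weight_pos := div_pos e.weight_pos (by exact_mod_cast hm)

/-- The list of events in which each event of `σ` is cut into `m` equal ones. -/
def EventStream.subdivide {A : Type*} (σ : EventStream A) (m : ℕ) (hm : 0 < m) :
    List (StreamEvent A) :=
  List.ofFn fun j : Fin (σ.length * m) =>
    (σ.1[(j : ℕ) / m]'(Nat.div_lt_of_lt_mul (lt_of_lt_of_eq j.2 (Nat.mul_comm _ _)))).divNat m hm

theorem EventStream.length_subdivide {A : Type*} (σ : EventStream A) (m : ℕ) (hm : 0 < m) :
    (σ.subdivide m hm).length = σ.length * m := List.length_ofFn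

/-- Exponents of one-letter exponentials add, so the `k`-th power has weight `k λ / m`. -/
theorem expEventMap_divNat_pow {A : Type*} [DecidableEq A] (e : StreamEvent A) (m : ℕ)
    (hm : 0 < m) : expEventMap A (e.divNat m hm) ^ m = expEventMap A e := by
  have key : ∀ k : ℕ, expEventMap A (e.divNat m hm) ^ k = FeatureSpace.ofLetter e.letter
      fun n => (k * (e.weight / m)) ^ n / (Nat.factorial n : ℝ) := by
    intro k
    induction k with
    | zero =>
      funext w
      cases w <;> simp [FeatureSpace.one_nil, FeatureSpace.one_cons, FeatureSpace.ofLetter_apply]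
    | succ k ih =>
      rw [pow_succ, ih, expEventMap_eq_ofLetter]
      refine (FeatureSpace.ofLetter_mul e.letter _ _).trans ?_
      congr 1
      funext n
      rw [Nat.cast_succ, add_one_mul, ← sum_pow_div_factorial_mul]
      rfl
  have hm' : (m : ℝ) ≠ 0 := by exact_mod_cast hm.ne'
  rw [key, expEventMap_eq_ofLetter, mul_div_cancel₀ _ hm']

/-- The factors are grouped into blocks of `m`, each collapsing to one event of `σ`. -/
theorem EventStream.prod_map_exp_subdivide {A : Type*} [DecidableEq A] (σ : EventStream A) (m : ℕ)
    (hm : 0 < m) :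
    ((σ.subdivide m hm).map (expEventMap A)).prod = featureMap (expEventMap A) σ := by
  rw [subdivide, List.map_ofFn, List.ofFn_mul, List.prod_flatten, List.map_ofFn, featureMap]
  congr 1
  refine List.ext_getElem (by simp [length]) fun i h1 h2 => ?_
  have h3 : ∀ j : Fin m, (i * m + j) / m = i := fun j => by
    rw [mul_comm, Nat.mul_add_div hm, Nat.div_eq_of_lt j.2, add_zero]
  simp only [h3, List.getElem_ofFn, List.getElem_map, Function.comp_apply]
  exact (congrArg List.prod (List.ofFn_const m _)).trans
    ((List.prod_replicate m _).trans (expEventMap_divNat_pow (σ.1[i]'(by simpa using h2)) m hm))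

/-! ### Scaling limits -/

theorem eVariationOn_le_sub_add {α E : Type*} [LinearOrder α] [SeminormedAddCommGroup E]
    (f g : α → E) (s : Set α) :
    eVariationOn f s ≤ eVariationOn (fun t => f t - g t) s + eVariationOn g s := by
  refine iSup_le fun p => ?_
  refine le_trans ?_ (add_le_add (eVariationOn.sum_le p.2.2.1 p.2.2.2 (n := p.1))
    (eVariationOn.sum_le p.2.2.1 p.2.2.2 (n := p.1)))
  rw [← Finset.sum_add_distrib]
  refine Finset.sum_le_sum fun i _ => ?_
  simpa using edist_add_add_le (f (p.2.1 (i + 1)) - g (p.2.1 (i + 1))) (g (p.2.1 (i + 1)))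
    (f (p.2.1 i) - g (p.2.1 i)) (g (p.2.1 i))

theorem sum_norm_sub_le_of_eVariationOn_le {α E : Type*} [LinearOrder α]
    [SeminormedAddCommGroup E] {f : α → E} {δ : ℝ} (hδ : 0 ≤ δ)
    (hf : eVariationOn f Set.univ ≤ ENNReal.ofReal δ) {x : ℕ → α} (hx : Monotone x) (k : ℕ) :
    ∑ i ∈ Finset.range k, ‖f (x (i + 1)) - f (x i)‖ ≤ δ := by
  rw [← ENNReal.ofReal_le_ofReal_iff hδ, ENNReal.ofReal_sum_of_nonneg fun _ _ => norm_nonneg _]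
  refine le_trans (le_of_eq ?_) ((eVariationOn.sum_le hx (n := k) fun _ => Set.mem_univ _).trans hf)
  exact Finset.sum_congr rfl fun i _ => by rw [edist_dist, dist_eq_norm]

theorem prod_map_nil {A : Type*} [DecidableEq A] {p : StreamEvent A → FeatureSpace A}
    (hp : IsEventMap p) (l : List (StreamEvent A)) : (l.map p).prod [] = 1 := by
  induction l with
  | nil => rfl
  | cons e l ih => rw [List.map_cons, List.prod_cons, FeatureSpace.mul_nil, hp.nil, ih, one_mul]

theorem sum_weight_nonneg {A : Type*} (l : List (StreamEvent A)) :
    0 ≤ (l.map StreamEvent.weight).sum :=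
  List.sum_nonneg fun x hx => by
    obtain ⟨e, -, rfl⟩ := List.mem_map.1 hx
    exact e.weight_pos.le

theorem sum_weight_take_le {A : Type*} (l : List (StreamEvent A)) (k : ℕ) :
    ((l.take k).map StreamEvent.weight).sum ≤ (l.map StreamEvent.weight).sum := by
  conv_rhs => rw [← List.take_append_drop k l, List.map_append, List.sum_append]
  exact le_add_of_nonneg_right (sum_weight_nonneg _)

theorem sum_weight_take_succ {A : Type*} (l : List (StreamEvent A)) {i : ℕ} (hi : i < l.length) :
    ((l.take (i + 1)).map StreamEvent.weight).sum =
      ((l.take i).map StreamEvent.weight).sum + l[i].weight := by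
  rw [← List.take_append_getElem hi, List.map_append, List.sum_append, List.map_singleton,
    List.sum_singleton]

theorem prod_map_take_succ {A : Type*} (p : StreamEvent A → FeatureSpace A)
    (l : List (StreamEvent A)) {i : ℕ} (hi : i < l.length) :
    ((l.take (i + 1)).map p).prod = ((l.take i).map p).prod * p l[i] := by
  rw [← List.take_append_getElem hi, List.map_append, List.prod_append, List.map_singleton,
    List.prod_singleton]

section ScalingLimits

variable {A : Type*} [Fintype A] [DecidableEq A]

/-- The increments of `g` along the equidistant grid are the vectors of the events `l`. -/
def HasGridIncrements (l : List (StreamEvent A)) (g : unitInterval → EuclideanSpace ℝ A) : Prop :=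
  ∀ i (hi : i < l.length), g (gridPoint l.length (i + 1)) - g (gridPoint l.length i) =
    EuclideanSpace.single l[i].letter l[i].weight

/-- One step of the comparison of iterated sums with iterated integrals. -/
theorem abs_prod_map_take_sub_le {p : StreamEvent A → FeatureSpace A} (hp : IsEventMap p)
    {l : List (StreamEvent A)} {g γ : unitInterval → EuclideanSpace ℝ A}
    (hγ : BoundedVariationOn γ Set.univ) (hc : Continuous γ) (hstep : HasGridIncrements l g)
    {C δ : ℝ} (hδ : 0 ≤ δ) (hV : eVariationOn (fun t => g t - γ t) Set.univ ≤ ENNReal.ofReal δ)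
    (hC : (l.map StreamEvent.weight).sum ≤ C)
    (hmesh : ∀ i (hi : i < l.length), l[i].weight ≤ δ) (w : List A) (a : A)
    (hcont : ∀ i < l.length, ∀ y ∈ Set.Ioc (gridPoint l.length i) (gridPoint l.length (i + 1)),
      |iteratedIntegralTo γ hγ w y - iteratedIntegralTo γ hγ w (gridPoint l.length i)| ≤ δ)
    (hw : ∀ i < l.length, |((l.take i).map p).prod w -
      iteratedIntegralTo γ hγ w (gridPoint l.length i)| ≤ δ) (k : ℕ) (hk : k ≤ l.length) :
    |((l.take k).map p).prod (w ++ [a]) -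
        iteratedIntegralTo γ hγ (w ++ [a]) (gridPoint l.length k)| ≤
      δ * (Real.exp C + 2 * (coordMeasure γ hγ a).variation.real Set.univ +
        w.length * Real.exp C ^ 2 * C) := by
  have := SignedMeasure.isFiniteMeasure_variation (coordMeasure γ hγ a)
  set N := l.length
  set B := Real.exp C
  set s : ℕ → ℝ := fun i => ((l.take i).map StreamEvent.weight).sum with hs
  have hsC : ∀ i, s i ≤ C := fun i => (sum_weight_take_le l i).trans hC
  have hs0 : ∀ i, 0 ≤ s i := fun i => sum_weight_nonneg _
  have hB : ∀ i v, ((l.take i).map p).prod v ≤ B := fun i v =>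
    (prod_map_le_exp_sum hp _ v).trans (Real.exp_le_exp.2 (hsC i))
  have hstep' : ∀ i (hi : i < N), (if a = l[i].letter then l[i].weight else 0) =
      g (gridPoint N (i + 1)) a - g (gridPoint N i) a := by
    intro i hi
    rw [← PiLp.sub_apply, hstep i hi, PiLp.single_apply]
  have main := abs_sub_setIntegral_le (μ := coordMeasure γ hγ a)
    (continuous_iteratedIntegralTo hγ hc w) (coordMeasure_singleton hγ hc a 0)
    (monotone_gridPoint N) (gridPoint_zero N)
    (u := fun i => ((l.take i).map p).prod w) (v := fun i => ((l.take i).map p).prod (w ++ [a]))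
    (h := fun i => g (gridPoint N i) a)
    -- The quadratic remainder, with one factor of the weight bounded by `δ` and the other written
    -- as an increment of `s`, so that the sum telescopes.
    (r := fun i => w.length * B ^ 2 * δ * (s (i + 1) - s i)) (K := B) (δ := δ)
    (by cases w <;> rfl) k
    (fun i _ => (abs_of_nonneg (prod_map_nonneg hp _ _)).le.trans (hB i w))
    (fun i hi => hw i (hi.trans_le hk)) (fun i hi => hcont i (hi.trans_le hk)) ?_
  · rw [iteratedIntegralTo_append_singleton]
    refine main.trans ?_
    have h1 : ∑ i ∈ Finset.range k, |g (gridPoint N (i + 1)) a - g (gridPoint N i) a -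
        coordMeasure γ hγ a (Set.Ioc (gridPoint N i) (gridPoint N (i + 1)))| ≤ δ := by
      refine le_trans (Finset.sum_le_sum fun i _ => ?_)
        (sum_norm_sub_le_of_eVariationOn_le hδ hV (monotone_gridPoint N) k)
      rw [coordMeasure_Ioc hγ hc a (monotone_gridPoint N (Nat.le_succ i))]
      refine le_trans (le_of_eq ?_) (PiLp.norm_apply_le _ a)
      rw [Real.norm_eq_abs]
      congr 1
      simp only [PiLp.sub_apply]
      ring
    have h2 : (coordMeasure γ hγ a).variation.real (Set.Icc 0 (gridPoint N k)) ≤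
        (coordMeasure γ hγ a).variation.real Set.univ := measureReal_mono (Set.subset_univ _)
    have h3 : ∑ i ∈ Finset.range k, w.length * B ^ 2 * δ * (s (i + 1) - s i) ≤
        w.length * B ^ 2 * δ * C := by
      rw [← Finset.mul_sum, Finset.sum_range_sub]
      gcongr
      linarith [hsC k, hs0 0]
    have hB0 : 0 ≤ B := (Real.exp_pos C).le
    calc _ ≤ B * δ + 2 * δ * (coordMeasure γ hγ a).variation.real Set.univ +
          w.length * B ^ 2 * δ * C := by gcongr
      _ = _ := by ring
  · intro i hi
    have hi' := hi.trans_le hk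
    have hsi : s (i + 1) = s i + l[i].weight := sum_weight_take_succ l hi'
    have hpos := l[i].weight_pos
    have heB : Real.exp l[i].weight ≤ B :=
      Real.exp_le_exp.2 (by linarith [hsC (i + 1), hs0 i])
    simp only [prod_map_take_succ p l hi', ← hstep' i hi', hsi, add_sub_cancel_left]
    refine (abs_mul_eventMap_sub_le hp (prod_map_nonneg hp _) (hB i) l[i] heB w a).trans ?_
    rw [mul_assoc _ δ, sq l[i].weight]
    gcongr
    exact hmesh i hi'

theorem eventually_dist_gridPoint_lt {N : ℕ → ℕ} (hN : Tendsto N atTop atTop)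
    {E : Type*} [PseudoMetricSpace E] {F : unitInterval → E} (hF : Continuous F) {δ : ℝ}
    (hδ : 0 < δ) :
    ∀ᶠ n in atTop, ∀ i < N n, ∀ y ∈ Set.Icc (gridPoint (N n) i) (gridPoint (N n) (i + 1)),
      dist (F y) (F (gridPoint (N n) i)) < δ := by
  obtain ⟨η, hη, h⟩ := Metric.uniformContinuous_iff.1
    (CompactSpace.uniformContinuous_of_continuous hF) δ hδ
  have h1 : Tendsto (fun n => 1 / (N n : ℝ)) atTop (𝓝 0) :=
    tendsto_one_div_atTop_nhds_zero_nat.comp hN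
  filter_upwards [h1.eventually_lt_const hη] with n hn i hi y hy
  exact h ((dist_gridPoint_le hi hy).trans_lt hn)

/-- A weight is the norm of a grid increment of `g n`. The increment of `γ` is small by uniform
continuity on cells of length `1 / N`, that of `g n - γ` by its variation. -/
theorem eventually_weight_le {l : ℕ → List (StreamEvent A)}
    {g : ℕ → unitInterval → EuclideanSpace ℝ A} {γ : unitInterval → EuclideanSpace ℝ A}
    (hc : Continuous γ) (hN : Tendsto (fun n => (l n).length) atTop atTop)
    (hstep : ∀ n, HasGridIncrements (l n) (g n))
    (hV : Tendsto (fun n => eVariationOn (fun t => g n t - γ t) Set.univ) atTop (𝓝 0))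
    {δ : ℝ} (hδ : 0 < δ) :
    ∀ᶠ n in atTop, ∀ i (hi : i < (l n).length), (l n)[i].weight ≤ δ := by
  filter_upwards [eventually_dist_gridPoint_lt hN hc (half_pos hδ),
    ENNReal.tendsto_nhds_zero.1 hV _ (ENNReal.ofReal_pos.2 (half_pos hδ))] with n h1 h2 i hi
  set N := (l n).length
  have hle : gridPoint N i ≤ gridPoint N (i + 1) := monotone_gridPoint N (Nat.le_succ i)
  have h3 := h1 i hi _ ⟨hle, le_rfl⟩
  have h4 : dist (g n (gridPoint N (i + 1)) - γ (gridPoint N (i + 1)))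
      (g n (gridPoint N i) - γ (gridPoint N i)) ≤ δ / 2 :=
    (edist_le_ofReal (half_pos hδ).le).1
      ((eVariationOn.edist_le _ (Set.mem_univ _) (Set.mem_univ _)).trans h2)
  have h5 : (l n)[i].weight = ‖g n (gridPoint N (i + 1)) - g n (gridPoint N i)‖ := by
    rw [hstep n i hi, PiLp.norm_single, Real.norm_eq_abs, abs_of_pos (l n)[i].weight_pos]
  rw [dist_eq_norm] at h3 h4
  have h6 := norm_add_le
    (g n (gridPoint N (i + 1)) - γ (gridPoint N (i + 1)) - (g n (gridPoint N i) - γ (gridPoint N i)))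
    (γ (gridPoint N (i + 1)) - γ (gridPoint N i))
  have h7 : g n (gridPoint N (i + 1)) - γ (gridPoint N (i + 1)) -
      (g n (gridPoint N i) - γ (gridPoint N i)) + (γ (gridPoint N (i + 1)) - γ (gridPoint N i)) =
      g n (gridPoint N (i + 1)) - g n (gridPoint N i) := by abel
  rw [h7, ← h5] at h6
  linarith

theorem eventually_abs_prod_map_take_sub_le {p : StreamEvent A → FeatureSpace A}
    (hp : IsEventMap p) {l : ℕ → List (StreamEvent A)}
    {g : ℕ → unitInterval → EuclideanSpace ℝ A} {γ : unitInterval → EuclideanSpace ℝ A}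
    (hγ : BoundedVariationOn γ Set.univ) (hc : Continuous γ)
    (hN : Tendsto (fun n => (l n).length) atTop atTop)
    (hstep : ∀ n, HasGridIncrements (l n) (g n))
    (hV : Tendsto (fun n => eVariationOn (fun t => g n t - γ t) Set.univ) atTop (𝓝 0))
    {C : ℝ} (hC : ∀ᶠ n in atTop, ((l n).map StreamEvent.weight).sum ≤ C) (w : List A)
    {ε : ℝ} (hε : 0 < ε) :
    ∀ᶠ n in atTop, ∀ k ≤ (l n).length, |(((l n).take k).map p).prod w -
      iteratedIntegralTo γ hγ w (gridPoint (l n).length k)| ≤ ε := by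
  induction w using List.reverseRecOn generalizing ε with
  | nil =>
    refine Eventually.of_forall fun n k _ => ?_
    rw [prod_map_nil hp]
    simp [iteratedIntegralTo, hε.le]
  | append_singleton w a ih =>
    set D := Real.exp C + 2 * (coordMeasure γ hγ a).variation.real Set.univ +
      w.length * Real.exp C ^ 2 * C with hD
    -- `D` depends on neither `n` nor `k`, and one step multiplies the error by at most `D`.
    have hδ : 0 < ε / (|D| + 1) := by positivity
    filter_upwards [ih hδ, hC, eventually_weight_le hc hN hstep hV hδ,
      eventually_dist_gridPoint_lt hN (continuous_iteratedIntegralTo hγ hc w) hδ,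
      ENNReal.tendsto_nhds_zero.1 hV _ (ENNReal.ofReal_pos.2 hδ)] with n h1 h2 h3 h4 h5 k hk
    refine (abs_prod_map_take_sub_le hp hγ hc (hstep n) hδ.le h5 h2 h3 w a
      (fun i hi y hy => (h4 i hi y ⟨hy.1.le, hy.2⟩).le) (fun i hi => h1 i hi.le) k hk).trans ?_
    rw [← hD, div_mul_eq_mul_div, div_le_iff₀ (by positivity)]
    exact mul_le_mul_of_nonneg_left (by linarith [le_abs_self D]) hε.le

theorem tendsto_prod_map_iteratedIntegrals {p : StreamEvent A → FeatureSpace A}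
    (hp : IsEventMap p) {l : ℕ → List (StreamEvent A)}
    {g : ℕ → unitInterval → EuclideanSpace ℝ A} {γ : unitInterval → EuclideanSpace ℝ A}
    (hγ : BoundedVariationOn γ Set.univ) (hc : Continuous γ)
    (hN : Tendsto (fun n => (l n).length) atTop atTop)
    (hstep : ∀ n, HasGridIncrements (l n) (g n))
    (hV : Tendsto (fun n => eVariationOn (fun t => g n t - γ t) Set.univ) atTop (𝓝 0))
    {C : ℝ} (hC : ∀ᶠ n in atTop, ((l n).map StreamEvent.weight).sum ≤ C) (w : List A) :
    Tendsto (fun n => ((l n).map p).prod w) atTop (𝓝 (iteratedIntegrals γ hγ w)) := by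
  refine Metric.tendsto_nhds.2 fun ε hε => ?_
  filter_upwards [eventually_abs_prod_map_take_sub_le hp hγ hc hN hstep hV hC w (half_pos hε),
    hN.eventually_ge_atTop 1] with n h1 h2
  have h3 := h1 _ le_rfl
  rw [List.take_length, gridPoint_self (by omega)] at h3
  exact h3.trans_lt (half_lt_self hε)

/-- The norm of a stream is the variation of its path, eventually at most that of `γ` plus `1`. -/
theorem exists_eventually_norm₁_le {σ : ℕ → EventStream A}
    {γ : unitInterval → EuclideanSpace ℝ A} (hγ : BoundedVariationOn γ Set.univ)
    (hV : Tendsto (fun n => eVariationOn (fun t => (σ n).path t - γ t) Set.univ) atTop (𝓝 0)) :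
    ∃ C, ∀ᶠ n in atTop, (σ n).norm₁ ≤ C := by
  refine ⟨(1 + eVariationOn γ Set.univ).toReal, ?_⟩
  filter_upwards [ENNReal.tendsto_nhds_zero.1 hV 1 one_pos] with n hn
  rw [← ENNReal.ofReal_le_iff_le_toReal (ENNReal.add_ne_top.2 ⟨ENNReal.one_ne_top, hγ⟩),
    ← EventStream.eVariationOn_path]
  exact (eVariationOn_le_sub_add _ γ _).trans (add_le_add_left hn _)

/-- The total weight is the level sum at `1` of the exponential features, which subdivision
preserves. -/
theorem EventStream.sum_weight_subdivide (σ : EventStream A) (m : ℕ) (hm : 0 < m) :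
    ((σ.subdivide m hm).map StreamEvent.weight).sum = σ.norm₁ := by
  have h := levelSum_prod_map_exp (σ.subdivide m hm) 1
  rw [σ.prod_map_exp_subdivide, featureMap, levelSum_prod_map_exp] at h
  simpa [σ.norm₁_eq] using h.symm

theorem EventStream.hasGridIncrements_path (σ : EventStream A) : HasGridIncrements σ.1 σ.path :=
  fun _ hi => (σ.path_gridPoint_succ_sub hi).trans (σ.stepVector_of_lt hi)

theorem EventStream.hasGridIncrements_subdivide (σ : EventStream A) (m : ℕ) (hm : 0 < m) :
    HasGridIncrements (σ.subdivide m hm) σ.path := by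
  intro j hj
  have hj' : j < σ.length * m := by rwa [σ.length_subdivide] at hj
  have hjm : j / m < σ.1.length :=
    Nat.div_lt_of_lt_mul (lt_of_lt_of_eq hj' (Nat.mul_comm _ _))
  rw [σ.length_subdivide, σ.path_mul_gridPoint_succ_sub hm.ne' hj', σ.stepVector_of_lt hjm]
  have he : (σ.subdivide m hm)[j] = (σ.1[j / m]).divNat m hm := by
    exact List.getElem_ofFn _
  rw [he]
  generalize σ.1[j / m] = e
  ext b
  simp only [StreamEvent.divNat, PiLp.smul_apply, PiLp.single_apply, smul_eq_mul]
  split_ifs <;> ring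

theorem tendsto_featureMap_exp {σ : ℕ → EventStream A} {γ : unitInterval → EuclideanSpace ℝ A}
    (hγ : BoundedVariationOn γ Set.univ) (hc : Continuous γ)
    (hV : Tendsto (fun n => eVariationOn (fun t => (σ n).path t - γ t) Set.univ) atTop (𝓝 0))
    (w : List A) :
    Tendsto (fun n => featureMap (expEventMap A) (σ n) w) atTop
      (𝓝 (iteratedIntegrals γ hγ w)) := by
  obtain ⟨C, hC⟩ := exists_eventually_norm₁_le hγ hV
  have h := tendsto_prod_map_iteratedIntegrals isEventMap_exp
    -- Cutting into `n + 1` parts forces the number of events to infinity without changing features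
    -- or path.
    (l := fun n => (σ n).subdivide (n + 1) n.succ_pos) hγ hc ?_
    (fun n => (σ n).hasGridIncrements_subdivide (n + 1) n.succ_pos) hV
    (hC.mono fun n hn => ((σ n).sum_weight_subdivide _ _).trans_le hn) w
  · simpa only [EventStream.prod_map_exp_subdivide] using h
  · refine tendsto_atTop_mono (fun n => ?_) tendsto_id
    rw [EventStream.length_subdivide, id]
    nlinarith [(σ n).length_pos]

theorem tendsto_featureMap_lin {σ : ℕ → EventStream A} {γ : unitInterval → EuclideanSpace ℝ A}
    (hγ : BoundedVariationOn γ Set.univ) (hc : Continuous γ)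
    (hV : Tendsto (fun n => eVariationOn (fun t => (σ n).path t - γ t) Set.univ) atTop (𝓝 0))
    (hN : Tendsto (fun n => (σ n).length) atTop atTop) (w : List A) :
    Tendsto (fun n => featureMap (linEventMap A) (σ n) w) atTop
      (𝓝 (iteratedIntegrals γ hγ w)) := by
  obtain ⟨C, hC⟩ := exists_eventually_norm₁_le hγ hV
  exact tendsto_prod_map_iteratedIntegrals isEventMap_lin (l := fun n => (σ n).1) hγ hc hN
    (fun n => (σ n).hasGridIncrements_path) hV
    (hC.mono fun n hn => (σ n).norm₁_eq.symm.trans_le hn) w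

end ScalingLimits

theorem theoremB2 {A : Type*} [Fintype A] [DecidableEq A]
    (p : StreamEvent A → FeatureSpace A) (hp : p = expEventMap A ∨ p = linEventMap A) :
    -- (1) scaling limits
    (∀ (σ : ℕ → EventStream A) (γ : C(unitInterval, EuclideanSpace ℝ A))
        (hγ : BoundedVariationOn γ Set.univ),
      Tendsto (fun n => eVariationOn (fun t => (σ n).path t - γ t) Set.univ) atTop (𝓝 0) →
      (p = linEventMap A → Tendsto (fun n => (σ n).length) atTop atTop) →
      (∀ w : List A, Tendsto (fun n => featureMap p (σ n) w) atTop
        (𝓝 (iteratedIntegrals γ hγ w))) ∧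
      (iteratedIntegrals γ hγ).IsGroupLike) ∧
    -- (2) norms and estimates
    (∀ σ : EventStream A,
      eVariationOn σ.path Set.univ = ENNReal.ofReal σ.norm₁ ∧
      (∀ M : ℕ, (featureMap p σ).normLevel M ≤ σ.norm₁ ^ M / (Nat.factorial M : ℝ)) ∧
      (featureMap p σ).norm₁ ≤ ENNReal.ofReal (Real.exp σ.norm₁) ∧
      (p = expEventMap A →
        (∀ M : ℕ, (featureMap p σ).normLevel M = σ.norm₁ ^ M / (Nat.factorial M : ℝ)) ∧
        (featureMap p σ).norm₁ = ENNReal.ofReal (Real.exp σ.norm₁))) ∧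
    -- (3) concatenation of streams is multiplication of features
    (∀ σ τ : EventStream A,
      featureMap p (σ.concat τ) = featureMap p σ * featureMap p τ) := by
  have hp' : IsEventMap p := by
    rcases hp with rfl | rfl
    exacts [isEventMap_exp, isEventMap_lin]
  refine ⟨fun σ γ hγ hV hN => ⟨?_, ?_⟩, fun σ => ⟨σ.eVariationOn_path,
    normLevel_featureMap_le hp' σ, norm₁_featureMap_le hp' σ, ?_⟩, fun σ τ => ?_⟩
  · rcases hp with rfl | rfl
    exacts [tendsto_featureMap_exp hγ γ.continuous hV,
      tendsto_featureMap_lin hγ γ.continuous hV (hN rfl)]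
  -- For either `p` the exponential features of the same streams are used: those of `1 + λ a` are
  -- group-like only in the limit.
  · exact FeatureSpace.IsGroupLike.of_tendsto
      (fun n => FeatureSpace.isGroupLike_featureMap_exp (σ n))
      (tendsto_featureMap_exp hγ γ.continuous hV)
  · rintro rfl
    exact ⟨normLevel_featureMap_exp σ, norm₁_featureMap_exp σ⟩
  · simp [featureMap, EventStream.concat]

end
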